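/- **Conventions.** For a semigroup $S$, let $a\,\mathcal R^*\,b$ mean that for all $x,y\in S^1$, $xa=ya\iff xb=yb$; $\mathcal L^*$ is defined dually. $\mathcal L,\mathcal R$ are Green's relations and $E(S)$ is the set of idempotents. $S$ is *abundant* if each $\mathcal R^*$-class and each $\mathcal L^*$-class contains an idempotent; *adequate* if it is abundant and its idempotents commute (then $a^+$, $a^*$ denote the unique idempotents in the $\mathcal R^*$-class and $\mathcal L^*$-class of $a$); *quasi-adequate* if it is abundant and $E(S)$ is a subsemigroup; *left adequate* if it is abundant and each $\mathcal R^*$-class contains a unique idempotent (again written $a^+$); *left ample* if it is left adequate and $ae=(ae)^+a$ for all $a\in S$, $e\in E(S)$. An *adequate transversal* of an abundant semigroup $S$ is an adequate subsemigroup $S^0$ such that $\mathcal R^*(S^0),\mathcal L^*(S^0)$ are the restrictions of $\mathcal R^*(S),\mathcal L^*(S)$, and such that for each $x\in S$ there is a unique $\bar x\in S^0$ for which there exist $e,f\in E(S)$ with $x=e\bar xf$, $e\,\mathcal L\,\bar x^+$, $f\,\mathcal R\,\bar x^*$; then $e=e_x$ and $f=f_x$ are unique, and $I(S)=\{e_x: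 x\in S\}$. It is *admissible* if $\overline{xy}=\bar x\,\bar y$ for all $x,y\in S$. A *left regular band* is a semigroup of idempotents with $efe=ef$; a subsemilattice $E^0$ of a band $I$ is a *semilattice transversal* if every element of $I$ has exactly one inverse in $E^0$. **Theorem.** Let $S^0$ be a left ample adequate semigroup with semilattice of idempotents $E^0$, and let $I$ be a left regular band with a semilattice transversal (isomorphic to, and identified with) $E^0$; for $u\in E^0$ let $L_u$ be the $\mathcal L$-class of $u$ in $I$. Let $(x,e)\mapsto x*e$ be a left action of $S^0$ on $I$, so $(xy)*e=x*(y*e)$, with $x*(ef)=(x*e)(x*f)$ for all $x\in S^0$, $e,f\in I$, such that 1. $x*y^+=(xy)^+$ for all $x,y\in S^0$; 2. for all $x,x_1,x_2\in S^0$, $e_1\in L_{x_1^+}$, $e_2\in L_{x_2^+}$: if $x^+(x*e_1)=x^+(x*e_2)$ and $xx_1=xx_2$, then $x^* *e_1=x^* *e_2$ and $x^*x_1=x^*x_2$. Let $W=\{(e,x)\in I\times S^0: e\in L_{x^+}\}$ with $(e,x)(g,y)=(e(x*g),xy)$. Then $W$ is a left adequate, quasi-adequate semigroup, and it has an admissible,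 left ample, adequate transversal $W^0=\{(x^+,x):x\in S^0\}$, with $x\mapsto(x^+,x)$ an isomorphism $S^0\to W^0$. If in addition 3. $x^+*e=x^+e$ for all $x\in S^0$, $e\in I$, then $I(W)$ (formed with respect to $W^0$) is a subsemigroup of $W$ and $I(W)\cong I$. Conversely, let $S$ be a left adequate, quasi-adequate semigroup with an admissible, left ample, adequate transversal $S^0$, and let $E^0=E(S^0)$. Then there are a left regular band $I$ with a semilattice transversal isomorphic to $E^0$ and a distributive left action of $S^0$ on $I$ satisfying (1), (2) and (3), and an isomorphism $S\to W$ onto the semigroup $W$ built from these data, which sends each $t\in S^0$ to $(t^+,t)$. -/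

import Mathlib

universe u v w

namespace AdequateTransversal

/-- Green's relation `L`: `a` and `b` generate the same principal left ideal `S¹a = S¹b`. -/
def GreenL {S : Type u} [Semigroup S] (a b : S) : Prop :=
  (∃ x : WithOne S, x * (a : WithOne S) = b) ∧ ∃ y : WithOne S, y * (b : WithOne S) = a

/-- Green's relation `R`: `a` and `b` generate the same principal right ideal `aS¹ = bS¹`. -/
def GreenR {S : Type u} [Semigroup S] (a b : S) : Prop :=
  (∃ x : WithOne S, (a : WithOne S) * x = b) ∧ ∃ y : WithOne S, (b : WithOne S) * y = a

/-- The relation `R*`: `xa = ya ↔ xb = yb` for all `x, y ∈ S¹`. -/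
def RStar {S : Type u} [Semigroup S] (a b : S) : Prop :=
  ∀ x y : WithOne S, x * (a : WithOne S) = y * (a : WithOne S) ↔
    x * (b : WithOne S) = y * (b : WithOne S)

/-- The relation `L*`: `ax = ay ↔ bx = by` for all `x, y ∈ S¹`. -/
def LStar {S : Type u} [Semigroup S] (a b : S) : Prop :=
  ∀ x y : WithOne S, (a : WithOne S) * x = (a : WithOne S) * y ↔
    (b : WithOne S) * x = (b : WithOne S) * y

/-- Every `R*`-class and every `L*`-class contains an idempotent. -/
structure IsAbundant (S : Type u) [Semigroup S] : Prop where
  exists_rStar : ∀ a : S, ∃ e : S, IsIdempotentElem e ∧ RStar e a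
  exists_lStar : ∀ a : S, ∃ e : S, IsIdempotentElem e ∧ LStar e a

/-- Abundant with commuting idempotents. -/
structure IsAdequate (S : Type u) [Semigroup S] : Prop extends IsAbundant S where
  idem_comm : ∀ e f : S, IsIdempotentElem e → IsIdempotentElem f → e * f = f * e

/-- Abundant, and the idempotents form a subsemigroup. -/
structure IsQuasiAdequate (S : Type u) [Semigroup S] : Prop extends IsAbundant S where
  idem_mul : ∀ e f : S, IsIdempotentElem e → IsIdempotentElem f → IsIdempotentElem (e * f)

/-- Abundant, and every `R*`-class contains a unique idempotent. -/
structure IsLeftAdequate (S : Type u) [Semigroup S] : Prop extends IsAbundant S where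
  existsUnique_rStar : ∀ a : S, ∃! e : S, IsIdempotentElem e ∧ RStar e a

/-- Left adequate, and `ae = (ae)⁺a` for every `a` and every idempotent `e`, where `(ae)⁺` is the
idempotent `p` in the `R*`-class of `ae`. -/
structure IsLeftAmple (S : Type u) [Semigroup S] : Prop extends IsLeftAdequate S where
  ample : ∀ a e p : S, IsIdempotentElem e → IsIdempotentElem p → RStar p (a * e) →
    a * e = p * a

/-- The semilattice `E(S)` of idempotents of an adequate semigroup `S`. -/
def IsAdequate.semilattice {S : Type u} [Semigroup S] (h : IsAdequate S) : Subsemigroup S where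
  carrier := {e | IsIdempotentElem e}
  mul_mem' {e f} he hf := IsIdempotentElem.mul_of_commute (h.idem_comm e f he hf) he hf

/-- `a⁺`: the (unique) idempotent in the `R*`-class of `a`, as an element of `E(S)`. -/
noncomputable def IsAdequate.plus {S : Type u} [Semigroup S] (h : IsAdequate S) (a : S) :
    h.semilattice :=
  ⟨(h.exists_rStar a).choose, (h.exists_rStar a).choose_spec.1⟩

/-- `a*`: the (unique) idempotent in the `L*`-class of `a`, as an element of `E(S)`. -/
noncomputable def IsAdequate.star {S : Type u} [Semigroup S] (h : IsAdequate S) (a : S) :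
    h.semilattice :=
  ⟨(h.exists_lStar a).choose, (h.exists_lStar a).choose_spec.1⟩

theorem IsAdequate.plus_rStar {S : Type u} [Semigroup S] (h : IsAdequate S) (a : S) :
    RStar (h.plus a : S) a :=
  (h.exists_rStar a).choose_spec.2

theorem IsAdequate.star_lStar {S : Type u} [Semigroup S] (h : IsAdequate S) (a : S) :
    LStar (h.star a : S) a :=
  (h.exists_lStar a).choose_spec.2

/-- An idempotent `e` in the `R*`-class of `a` equals `a⁺`. -/
theorem IsAdequate.eq_plus {S : Type u} [Semigroup S] (h : IsAdequate S) {a e : S}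
    (he : IsIdempotentElem e) (hea : RStar e a) : e = h.plus a := by
  obtain ⟨p, hp⟩ : ∃ p : S, p = h.plus a := ⟨_, rfl⟩
  have hpi : IsIdempotentElem p := hp ▸ (h.plus a).2
  have hpe : ∀ x y : WithOne S, x * (p : WithOne S) = y * (p : WithOne S) ↔
      x * (e : WithOne S) = y * (e : WithOne S) := fun x y =>
    (hp ▸ h.plus_rStar a x y).trans (hea x y).symm
  have h1 : p * e = e := by
    have := (hpe (p : WithOne S) 1).1 (by rw [one_mul]; exact_mod_cast hpi)
    rw [one_mul] at this
    exact_mod_cast this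
  have h2 : e * p = p := by
    have := (hpe (e : WithOne S) 1).2 (by rw [one_mul]; exact_mod_cast he)
    rw [one_mul] at this
    exact_mod_cast this
  rw [← hp, ← h1, h.idem_comm p e hpi he, h2]

/-- An idempotent `e` in the `L*`-class of `a` equals `a*`. -/
theorem IsAdequate.eq_star {S : Type u} [Semigroup S] (h : IsAdequate S) {a e : S}
    (he : IsIdempotentElem e) (hea : LStar e a) : e = h.star a := by
  obtain ⟨p, hp⟩ : ∃ p : S, p = h.star a := ⟨_, rfl⟩
  have hpi : IsIdempotentElem p := hp ▸ (h.star a).2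
  have hpe : ∀ x y : WithOne S, (p : WithOne S) * x = (p : WithOne S) * y ↔
      (e : WithOne S) * x = (e : WithOne S) * y := fun x y =>
    (hp ▸ h.star_lStar a x y).trans (hea x y).symm
  have h1 : e * p = e := by
    have := (hpe (p : WithOne S) 1).1 (by rw [mul_one]; exact_mod_cast hpi)
    rw [mul_one] at this
    exact_mod_cast this
  have h2 : p * e = p := by
    have := (hpe (e : WithOne S) 1).2 (by rw [mul_one]; exact_mod_cast he)
    rw [mul_one] at this
    exact_mod_cast this
  rw [← hp, ← h1, h.idem_comm e p he hpi, h2]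

/-- A `*`-subsemigroup: an abundant subsemigroup `T` of `S` whose relations `R*` and `L*` are the
restrictions of those of `S`. -/
structure IsStarSubsemigroup {S : Type u} [Semigroup S] (T : Subsemigroup S) : Prop where
  abundant : IsAbundant T
  rStar_iff : ∀ a b : T, RStar a b ↔ RStar (a : S) (b : S)
  lStar_iff : ∀ a b : T, LStar a b ↔ LStar (a : S) (b : S)

/-- `x = e t f` with `e, f` idempotents of `S`, `t ∈ T`, `e L t⁺` and `f R t*`. -/
structure IsDecomposition {S : Type u} [Semigroup S] {T : Subsemigroup S} (hT : IsAdequate T)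
    (x e : S) (t : T) (f : S) : Prop where
  idem_left : IsIdempotentElem e
  idem_right : IsIdempotentElem f
  eq_mul : x = e * t * f
  greenL : GreenL e ((hT.plus t : T) : S)
  greenR : GreenR f ((hT.star t : T) : S)

/-- `T` is an adequate transversal of the abundant semigroup `S`. -/
structure IsAdequateTransversal {S : Type u} [Semigroup S] (T : Subsemigroup S) : Prop where
  abundant : IsAbundant S
  adequate : IsAdequate T
  starSubsemigroup : IsStarSubsemigroup T
  existsUnique : ∀ x : S, ∃! t : T, ∃ e f : S, IsDecomposition adequate x e t f

/-- The element `x̄ ∈ T` in the decomposition `x = e x̄ f`. -/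
noncomputable def IsAdequateTransversal.bar {S : Type u} [Semigroup S] {T : Subsemigroup S}
    (h : IsAdequateTransversal T) (x : S) : T :=
  (h.existsUnique x).choose

/-- The transversal is admissible: the bar of `xy` is the product of the bars of `x` and `y`. -/
def IsAdequateTransversal.IsAdmissible {S : Type u} [Semigroup S] {T : Subsemigroup S}
    (h : IsAdequateTransversal T) : Prop :=
  ∀ x y : S, h.bar (x * y) = h.bar x * h.bar y

/-- The set `I(S) = {e_x : x ∈ S}` of the left factors of the decompositions `x = e_x x̄ f_x`. -/
def IsAdequateTransversal.leftSet {S : Type u} [Semigroup S] {T : Subsemigroup S}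
    (h : IsAdequateTransversal T) : Set S :=
  {e | ∃ (x : S) (f : S), IsDecomposition h.adequate x e (h.bar x) f}

/-- A left regular band. -/
structure IsLeftRegularBand (I : Type v) [Semigroup I] : Prop where
  idem : ∀ e : I, e * e = e
  left_regular : ∀ e f : I, e * f * e = e * f

/-- `y` is an inverse of `x`, i.e. `y ∈ V(x)`. -/
def IsInverseOf {I : Type v} [Semigroup I] (y x : I) : Prop :=
  x * y * x = x ∧ y * x * y = y

/-- The homomorphism `ι : E → I` embeds the semilattice `E` as a transversal of `I`: every element
of `I` has exactly one inverse in the copy of `E`. -/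
structure IsSemilatticeTransversal {E : Type u} {I : Type v} [Semigroup E] [Semigroup I]
    (ι : E →ₙ* I) : Prop where
  injective : Function.Injective ι
  existsUnique_inverse : ∀ x : I, ∃! e : E, IsInverseOf (ι e) x

/-- A left action of the semigroup `S` on `I`, distributive over the multiplication of `I`. -/
structure DistribAction (S : Type u) (I : Type v) [Semigroup S] [Semigroup I] where
  act : S → I → I
  mul_act : ∀ (x y : S) (e : I), act (x * y) e = act x (act y e)
  act_mul : ∀ (x : S) (e f : I), act x (e * f) = act x e * act x f

/-- The underlying set `I × S` of the semidirect product. -/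
@[ext]
structure DistribAction.Semidirect {S : Type u} {I : Type v} [Semigroup S] [Semigroup I]
    (A : DistribAction S I) where
  left : I
  right : S

/-- The semidirect product, with `(e, x)(g, y) = (e (x ∗ g), x y)`. -/
instance DistribAction.instSemigroupSemidirect {S : Type u} {I : Type v} [Semigroup S]
    [Semigroup I] (A : DistribAction S I) : Semigroup A.Semidirect where
  mul p q := ⟨p.left * A.act p.right q.left, p.right * q.right⟩
  mul_assoc p q r := by
    apply DistribAction.Semidirect.ext
    · change p.left * A.act p.right q.left * A.act (p.right * q.right) r.left =
        p.left * A.act p.right (q.left * A.act q.right r.left)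
      rw [A.mul_act, A.act_mul, mul_assoc]
    · exact mul_assoc _ _ _

/-- `x ∗ y⁺ = (xy)⁺`, where `E(S)` is identified with its copy in `I`. -/
def PlusCondition {S : Type u} {I : Type v} [Semigroup S] [Semigroup I] (hS : IsAdequate S)
    (ι : hS.semilattice →ₙ* I) (A : DistribAction S I) : Prop :=
  ∀ x y : S, A.act x (ι (hS.plus y)) = ι (hS.plus (x * y))

/-- For `e₁ ∈ L_{x₁⁺}`, `e₂ ∈ L_{x₂⁺}`: if `x⁺(x ∗ e₁) = x⁺(x ∗ e₂)` and `x x₁ = x x₂`, then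
`x* ∗ e₁ = x* ∗ e₂` and `x* x₁ = x* x₂`. -/
def CancellationCondition {S : Type u} {I : Type v} [Semigroup S] [Semigroup I]
    (hS : IsAdequate S) (ι : hS.semilattice →ₙ* I) (A : DistribAction S I) : Prop :=
  ∀ (x x₁ x₂ : S) (e₁ e₂ : I), GreenL e₁ (ι (hS.plus x₁)) → GreenL e₂ (ι (hS.plus x₂)) →
    ι (hS.plus x) * A.act x e₁ = ι (hS.plus x) * A.act x e₂ → x * x₁ = x * x₂ →
      A.act (hS.star x) e₁ = A.act (hS.star x) e₂ ∧
        (hS.star x : S) * x₁ = (hS.star x : S) * x₂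

/-- `x⁺ ∗ e = x⁺ e` for all `x ∈ S` and `e ∈ I`. -/
def RestrictionCondition {S : Type u} {I : Type v} [Semigroup S] [Semigroup I]
    (hS : IsAdequate S) (ι : hS.semilattice →ₙ* I) (A : DistribAction S I) : Prop :=
  ∀ (x : S) (e : I), A.act (hS.plus x) e = ι (hS.plus x) * e

/-- In a band, `a L b` if and only if `ab = a` and `ba = b`. -/
theorem IsLeftRegularBand.greenL_iff {I : Type v} [Semigroup I] (hI : IsLeftRegularBand I)
    {a b : I} : GreenL a b ↔ a * b = a ∧ b * a = b := by
  constructor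
  · rintro ⟨⟨x, hx⟩, ⟨y, hy⟩⟩
    have ha : (a : WithOne I) * a = a := by exact_mod_cast hI.idem a
    have hb : (b : WithOne I) * b = b := by exact_mod_cast hI.idem b
    constructor
    · have : (a : WithOne I) * b = a := by rw [← hy, mul_assoc, hb]
      exact_mod_cast this
    · have : (b : WithOne I) * a = b := by rw [← hx, mul_assoc, ha]
      exact_mod_cast this
  · rintro ⟨h1, h2⟩
    exact ⟨⟨b, by exact_mod_cast h2⟩, ⟨a, by exact_mod_cast h1⟩⟩

theorem IsAdequate.plus_mul_plus {S : Type u} [Semigroup S] (h : IsAdequate S) (x y : S) :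
    h.plus x * h.plus (x * y) = h.plus (x * y) := by
  apply Subtype.ext
  have hp : (h.plus x : S) * h.plus x = h.plus x := (h.plus x).2
  have hx : (h.plus x : S) * x = x := by
    have := (h.plus_rStar x (h.plus x : S) 1).1
      (by rw [one_mul]; exact_mod_cast hp)
    rw [one_mul] at this
    exact_mod_cast this
  have := (h.plus_rStar (x * y) (h.plus x : S) 1).2
    (by rw [one_mul]; exact_mod_cast (by rw [← mul_assoc, hx]))
  rw [one_mul] at this
  exact_mod_cast this

/-- The semigroup `W = {(e, x) : e ∈ L_{x⁺}}`, as a subsemigroup of the semidirect product. -/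
def semigroupW {S : Type u} {I : Type v} [Semigroup S] [Semigroup I] {hS : IsAdequate S}
    (hI : IsLeftRegularBand I) {ι : hS.semilattice →ₙ* I} {A : DistribAction S I}
    (h₁ : PlusCondition hS ι A) : Subsemigroup A.Semidirect where
  carrier := {p | GreenL p.left (ι (hS.plus p.right))}
  mul_mem' {p q} hp hq := by
    obtain ⟨e, x⟩ := p
    obtain ⟨g, y⟩ := q
    change GreenL e (ι (hS.plus x)) at hp
    change GreenL g (ι (hS.plus y)) at hq
    change GreenL (e * A.act x g) (ι (hS.plus (x * y)))
    rw [hI.greenL_iff] at hp hq ⊢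
    have h2 : A.act x g * ι (hS.plus (x * y)) = A.act x g := by
      rw [← h₁, ← A.act_mul, hq.1]
    have h3 : ι (hS.plus (x * y)) * A.act x g = ι (hS.plus (x * y)) := by
      rw [← h₁, ← A.act_mul, hq.2]
    have h4 : ι (hS.plus x) * ι (hS.plus (x * y)) = ι (hS.plus (x * y)) := by
      rw [← map_mul, hS.plus_mul_plus]
    have h5 : ι (hS.plus (x * y)) * ι (hS.plus x) = ι (hS.plus (x * y)) := by
      conv_lhs => rw [← h4, hI.left_regular]
      exact h4
    refine ⟨by rw [mul_assoc, h2], ?_⟩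
    calc ι (hS.plus (x * y)) * (e * A.act x g)
        = ι (hS.plus (x * y)) * (ι (hS.plus x) * e) * A.act x g := by
          rw [← mul_assoc (ι (hS.plus (x * y))) (ι (hS.plus x)) e, h5, mul_assoc]
      _ = ι (hS.plus (x * y)) := by rw [hp.2, h5, h3]

end AdequateTransversal

open AdequateTransversal

/-! In $W$ the second coordinate carries almost everything. If $e\in L_u$ and $uh=u$, then
$eh=(eu)h=e$, so left coordinates absorb on the right whatever $u$ absorbs
(`left_mul_act_of_plus_eq`). Hence $(e,x)$ is idempotent exactly when $x$ is, which reduces the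
products of idempotents of $W$ to the semilattice $E^0$. The idempotent $\mathcal R^*$-related to
$(e,x)$ is $(e,x^+)$. One that is $\mathcal L^*$-related to it is $(x^*,x^*)$, and the proof of this
is what condition (2) is designed for (`embedW_star_lStar`). Projecting any decomposition to $S^0$
shows that the bar of $(e,x)$ corresponds to $x$ (`eq_of_isDecomposition`), so admissibility is
immediate. Finally $I(W)=E(W)$, and under (3) the first projection identifies $E(W)$ with $I$.

For the converse take $I=E(S)$ and $t*e=(te)^+$. Triviality of $\mathcal R$ on idempotents makes
$E(S)$ left regular, and it forces $f_x=\bar x^*$ and $e_x=x^+$, so that $x=x^+\bar x$. The key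
identity is $te=(te)^+t$ for $t\in S^0$ and every idempotent $e$ of $S$
(`IsAdequateTransversal.mul_idem_eq`): left ampleness gives it only inside $S^0$, and admissibility
extends it. It yields distributivity and condition (2), and $x\mapsto(x^+,\bar x)$ is the
isomorphism. -/

namespace AdequateTransversal

/-! ### Starred and ordinary Green's relations on idempotents and subsemigroups. -/

section Basic

variable {S : Type u} [Semigroup S]

theorem RStar.symm {a b : S} (h : RStar a b) : RStar b a := fun x y => (h x y).symm

theorem RStar.trans {a b c : S} (h : RStar a b) (h' : RStar b c) : RStar a c :=
  fun x y => (h x y).trans (h' x y)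

theorem LStar.symm {a b : S} (h : LStar a b) : LStar b a := fun x y => (h x y).symm

theorem LStar.trans {a b c : S} (h : LStar a b) (h' : LStar b c) : LStar a c :=
  fun x y => (h x y).trans (h' x y)

theorem RStar.mul_left {a b : S} (h : RStar a b) (c : S) : RStar (c * a) (c * b) := by
  intro x y
  have := h (x * c) (y * c)
  simpa only [WithOne.coe_mul, mul_assoc] using this

theorem RStar.cancel {a b : S} (h : RStar a b) {x y : S} (hxy : x * a = y * a) :
    x * b = y * b := by
  have := (h x y).1 (by exact_mod_cast hxy)
  exact_mod_cast this

theorem RStar.fix {a b : S} (h : RStar a b) {x : S} (hx : x * a = a) : x * b = b := by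
  have := (h x 1).1 (by rw [one_mul]; exact_mod_cast hx)
  rw [one_mul] at this
  exact_mod_cast this

theorem LStar.cancel {a b : S} (h : LStar a b) {x y : S} (hxy : a * x = a * y) :
    b * x = b * y := by
  have := (h x y).1 (by exact_mod_cast hxy)
  exact_mod_cast this

theorem LStar.fix {a b : S} (h : LStar a b) {x : S} (hx : a * x = a) : b * x = b := by
  have := (h x 1).1 (by rw [mul_one]; exact_mod_cast hx)
  rw [mul_one] at this
  exact_mod_cast this

/-- To be `R*`-related to an idempotent left identity `e` of `a`, it suffices to cancel within
`S`. -/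
theorem rStar_of_idem {e a : S} (he : IsIdempotentElem e) (hea : e * a = a)
    (h : ∀ x y : S, x * a = y * a → x * e = y * e) : RStar e a := by
  -- The adjoined identity can be traded for `e`, since `e * a = a`; this settles the cases with a
  -- multiplier 1.
  have h1 : ∀ x : S, x * a = a → x * e = e := fun x hx => by
    rw [h x e (hx.trans hea.symm), he.eq]
  intro x y
  constructor
  · intro hxy
    rw [← hea, WithOne.coe_mul, ← mul_assoc, hxy, mul_assoc]
  · intro hxy
    induction x with
    | one =>
      induction y with
      | one => rfl
      | coe y =>
        rw [one_mul] at hxy ⊢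
        exact_mod_cast (h1 y (by exact_mod_cast hxy.symm)).symm
    | coe x =>
      induction y with
      | one =>
        rw [one_mul] at hxy ⊢
        exact_mod_cast h1 x (by exact_mod_cast hxy)
      | coe y => exact_mod_cast h x y (by exact_mod_cast hxy)

/-- To be `L*`-related to an idempotent right identity `e` of `a`, it suffices to cancel within
`S`. -/
theorem lStar_of_idem {e a : S} (he : IsIdempotentElem e) (hae : a * e = a)
    (h : ∀ x y : S, a * x = a * y → e * x = e * y) : LStar e a := by
  have h1 : ∀ x : S, a * x = a → e * x = e := fun x hx => by
    rw [h x e (hx.trans hae.symm), he.eq]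
  intro x y
  constructor
  · intro hxy
    rw [← hae, WithOne.coe_mul, mul_assoc, hxy, mul_assoc]
  · intro hxy
    induction x with
    | one =>
      induction y with
      | one => rfl
      | coe y =>
        rw [mul_one] at hxy ⊢
        exact_mod_cast (h1 y (by exact_mod_cast hxy.symm)).symm
    | coe x =>
      induction y with
      | one =>
        rw [mul_one] at hxy ⊢
        exact_mod_cast h1 x (by exact_mod_cast hxy)
      | coe y => exact_mod_cast h x y (by exact_mod_cast hxy)

/-- `R*`-related elements of a subsemigroup are related there if they are related in `S`. -/
theorem RStar.restrict {T : Subsemigroup S} {e a : T} (he : IsIdempotentElem e)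
    (h : RStar (e : S) (a : S)) : RStar e a := by
  refine rStar_of_idem he (Subtype.ext (h.fix (congrArg Subtype.val he.eq))) ?_
  intro x y hxy
  exact Subtype.ext (h.symm.cancel (congrArg Subtype.val hxy))

theorem LStar.restrict {T : Subsemigroup S} {e a : T} (he : IsIdempotentElem e)
    (h : LStar (e : S) (a : S)) : LStar e a := by
  refine lStar_of_idem he (Subtype.ext (h.fix (congrArg Subtype.val he.eq))) ?_
  intro x y hxy
  exact Subtype.ext (h.symm.cancel (congrArg Subtype.val hxy))

/-- An idempotent is a right identity on the left ideal it generates. Only the two elements need be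
idempotent, so this applies in $W$ and $S$, which are not bands in general. -/
theorem greenL_iff_of_idem {a b : S} (ha : IsIdempotentElem a) (hb : IsIdempotentElem b) :
    GreenL a b ↔ a * b = a ∧ b * a = b := by
  constructor
  · rintro ⟨⟨x, hx⟩, ⟨y, hy⟩⟩
    have ha : (a : WithOne S) * a = a := by exact_mod_cast ha
    have hb : (b : WithOne S) * b = b := by exact_mod_cast hb
    constructor
    · have : (a : WithOne S) * b = a := by rw [← hy, mul_assoc, hb]
      exact_mod_cast this
    · have : (b : WithOne S) * a = b := by rw [← hx, mul_assoc, ha]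
      exact_mod_cast this
  · rintro ⟨h1, h2⟩
    exact ⟨⟨b, by exact_mod_cast h2⟩, ⟨a, by exact_mod_cast h1⟩⟩

theorem greenR_iff_of_idem {a b : S} (ha : IsIdempotentElem a) (hb : IsIdempotentElem b) :
    GreenR a b ↔ a * b = b ∧ b * a = a := by
  constructor
  · rintro ⟨⟨x, hx⟩, ⟨y, hy⟩⟩
    have ha : (a : WithOne S) * a = a := by exact_mod_cast ha
    have hb : (b : WithOne S) * b = b := by exact_mod_cast hb
    constructor
    · have : (a : WithOne S) * b = b := by rw [← hx, ← mul_assoc, ha]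
      exact_mod_cast this
    · have : (b : WithOne S) * a = a := by rw [← hy, ← mul_assoc, hb]
      exact_mod_cast this
  · rintro ⟨h1, h2⟩
    exact ⟨⟨b, by exact_mod_cast h1⟩, ⟨a, by exact_mod_cast h2⟩⟩

theorem IsAdequate.plus_mul_self (h : IsAdequate S) (a : S) : (h.plus a : S) * a = a :=
  (h.plus_rStar a).fix (h.plus a).2

theorem IsAdequate.mul_star_self (h : IsAdequate S) (a : S) : a * (h.star a : S) = a :=
  (h.star_lStar a).fix (h.star a).2

theorem IsAdequate.plus_idem (h : IsAdequate S) {e : S} (he : IsIdempotentElem e) :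
    (h.plus e : S) = e :=
  (h.eq_plus he fun _ _ => Iff.rfl).symm

theorem IsAdequate.plus_semilattice (h : IsAdequate S) (e : h.semilattice) :
    h.plus (e : S) = e :=
  Subtype.ext (h.plus_idem e.2)

theorem IsAdequate.isLeftAdequate (h : IsAdequate S) : IsLeftAdequate S where
  toIsAbundant := h.toIsAbundant
  existsUnique_rStar a :=
    ⟨h.plus a, ⟨(h.plus a).2, h.plus_rStar a⟩, fun _ hy => h.eq_plus hy.1 hy.2⟩

/-- An adequate subsemigroup containing idempotents `R*`- and `L*`-related in `S` to each of its
elements is a `*`-subsemigroup. -/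
theorem isStarSubsemigroup_of_exists {T : Subsemigroup S} (hT : IsAdequate T)
    (hR : ∀ a : T, ∃ e : T, IsIdempotentElem e ∧ RStar (e : S) (a : S))
    (hL : ∀ a : T, ∃ e : T, IsIdempotentElem e ∧ LStar (e : S) (a : S)) :
    IsStarSubsemigroup T where
  abundant := hT.toIsAbundant
  rStar_iff a b := by
    obtain ⟨e, he, hea⟩ := hR a
    obtain ⟨f, hf, hfb⟩ := hR b
    constructor
    · intro hab
      -- Both idempotents lie in one `R*`-class of the adequate `T`, so they coincide and link `a`
      -- to `b` in `S`.
      have h1 := hT.eq_plus he ((hea.restrict he).trans hab)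
      rw [← hT.eq_plus hf (hfb.restrict hf)] at h1
      subst h1
      exact hea.symm.trans hfb
    · intro hab
      exact (hea.restrict he).symm.trans ((hea.trans hab).restrict he)
  lStar_iff a b := by
    obtain ⟨e, he, hea⟩ := hL a
    obtain ⟨f, hf, hfb⟩ := hL b
    constructor
    · intro hab
      have h1 := hT.eq_star he ((hea.restrict he).trans hab)
      rw [← hT.eq_star hf (hfb.restrict hf)] at h1
      subst h1
      exact hea.symm.trans hfb
    · intro hab
      exact (hea.restrict he).symm.trans ((hea.trans hab).restrict he)

end Basic

/-! ### The semigroup $W$: idempotents, abundance, left and quasi-adequacy. -/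

section Construction

variable {S₀ : Type u} {I : Type v} [Semigroup S₀] [Semigroup I] {hS : IsAdequate S₀}
  {hI : IsLeftRegularBand I} {ι : hS.semilattice →ₙ* I} {A : DistribAction S₀ I}
  {h₁ : PlusCondition hS ι A}

theorem mem_semigroupW {p : A.Semidirect} :
    p ∈ semigroupW hI h₁ ↔ p.left * ι (hS.plus p.right) = p.left ∧
      ι (hS.plus p.right) * p.left = ι (hS.plus p.right) :=
  hI.greenL_iff

theorem semigroupW_ext {p q : semigroupW hI h₁} (hl : p.1.left = q.1.left)
    (hr : p.1.right = q.1.right) : p = q :=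
  Subtype.ext (DistribAction.Semidirect.ext hl hr)

theorem semigroupW_mul_left (p q : semigroupW hI h₁) :
    (p * q).1.left = p.1.left * A.act p.1.right q.1.left := rfl

theorem semigroupW_mul_right (p q : semigroupW hI h₁) :
    (p * q).1.right = p.1.right * q.1.right := rfl

theorem semigroupW_left_mul (p : semigroupW hI h₁) :
    p.1.left * ι (hS.plus p.1.right) = p.1.left :=
  (mem_semigroupW.1 p.2).1

theorem semigroupW_mul_left_eq (p : semigroupW hI h₁) :
    ι (hS.plus p.1.right) * p.1.left = ι (hS.plus p.1.right) :=
  (mem_semigroupW.1 p.2).2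

/-- If `e ∈ L_{y⁺}` then `x ∗ e ∈ L_{(xy)⁺}`. -/
theorem plus_mul_act (q : semigroupW hI h₁) (x : S₀) :
    ι (hS.plus (x * q.1.right)) * A.act x q.1.left = ι (hS.plus (x * q.1.right)) := by
  rw [← h₁, ← A.act_mul, semigroupW_mul_left_eq]

/-- The absorption rule: with $u=p_2^+$, the left coordinate satisfies $e=eu$, and $u$ absorbs the
acted element by `plus_mul_act`. -/
theorem left_mul_act_of_plus_eq {p q : semigroupW hI h₁} {x : S₀}
    (h : hS.plus (x * q.1.right) = hS.plus p.1.right) :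
    p.1.left * A.act x q.1.left = p.1.left := by
  have := plus_mul_act q x
  rw [h] at this
  rw [← semigroupW_left_mul p, mul_assoc, this]

theorem left_mul_act {p q : semigroupW hI h₁} {x : S₀} (h : x * q.1.right = p.1.right) :
    p.1.left * A.act x q.1.left = p.1.left :=
  left_mul_act_of_plus_eq (congrArg hS.plus h)

theorem semigroupW_idem_iff {p : semigroupW hI h₁} :
    IsIdempotentElem p ↔ IsIdempotentElem p.1.right := by
  constructor
  · intro h
    exact congrArg (fun q : semigroupW hI h₁ => q.1.right) h
  · intro h
    exact semigroupW_ext (left_mul_act h) h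

/-- The element `(e, x⁺)` for `(e, x) ∈ W`. -/
noncomputable def plusW (p : semigroupW hI h₁) : semigroupW hI h₁ :=
  ⟨⟨p.1.left, hS.plus p.1.right⟩, mem_semigroupW.2 (by
    dsimp only
    rw [hS.plus_semilattice]
    exact ⟨semigroupW_left_mul p, semigroupW_mul_left_eq p⟩)⟩

theorem plusW_idem (p : semigroupW hI h₁) : IsIdempotentElem (plusW p) :=
  semigroupW_idem_iff.2 (hS.plus p.1.right).2

theorem plusW_rStar (p : semigroupW hI h₁) : RStar (plusW p) p := by
  refine rStar_of_idem (plusW_idem p) ?_ ?_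
  · exact semigroupW_ext (left_mul_act_of_plus_eq (p := p) (congrArg hS.plus (hS.plus_mul_self _)))
      (hS.plus_mul_self _)
  · intro x y hxy
    -- `plusW p` and `p` share their left coordinate, so the left coordinates of the products are
    -- the same as well.
    have hl : (x * p).1.left = (y * p).1.left := by rw [hxy]
    refine semigroupW_ext hl ?_
    exact (hS.plus_rStar p.1.right).symm.cancel
      (congrArg (fun q : semigroupW hI h₁ => q.1.right) hxy)

variable (hI h₁) in
/-- The embedding `x ↦ (x⁺, x)`. -/
noncomputable def embedW : S₀ →ₙ* semigroupW hI h₁ where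
  toFun x := ⟨⟨ι (hS.plus x), x⟩, mem_semigroupW.2 ⟨hI.idem _, hI.idem _⟩⟩
  map_mul' x y := by
    refine semigroupW_ext ?_ rfl
    change ι (hS.plus (x * y)) = ι (hS.plus x) * A.act x (ι (hS.plus y))
    rw [h₁, ← map_mul, hS.plus_mul_plus]

theorem embedW_injective : Function.Injective (embedW hI h₁) := fun _ _ h =>
  congrArg (fun q : semigroupW hI h₁ => q.1.right) h

theorem embedW_idem_iff {x : S₀} : IsIdempotentElem (embedW hI h₁ x) ↔ IsIdempotentElem x :=
  semigroupW_idem_iff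

theorem plusW_embedW (x : S₀) : plusW (embedW hI h₁ x) = embedW hI h₁ (hS.plus x) := by
  refine semigroupW_ext ?_ rfl
  change ι (hS.plus x) = ι (hS.plus (hS.plus x : S₀))
  rw [hS.plus_semilattice]

theorem mul_embedW_star (p : semigroupW hI h₁) :
    p * embedW hI h₁ (hS.star p.1.right) = p :=
  semigroupW_ext (left_mul_act (hS.mul_star_self _)) (hS.mul_star_self _)

/-- Condition (2) is the cancellation law of this `L*`-relation written in coordinates, with $e$
replaced by $x^+$. -/
theorem embedW_star_lStar (h₂ : CancellationCondition hS ι A) (p : semigroupW hI h₁) :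
    LStar (embedW hI h₁ (hS.star p.1.right)) p := by
  refine lStar_of_idem (embedW_idem_iff.2 (hS.star p.1.right).2) (mul_embedW_star p) ?_
  intro x y hxy
  have hl : p.1.left * A.act p.1.right x.1.left = p.1.left * A.act p.1.right y.1.left :=
    congrArg (fun q : semigroupW hI h₁ => q.1.left) hxy
  have hr : p.1.right * x.1.right = p.1.right * y.1.right :=
    congrArg (fun q : semigroupW hI h₁ => q.1.right) hxy
  -- Multiplying by $x^+$ on the left turns $e$ into $x^+$, because $x^+e=x^+$.
  have hl' : ι (hS.plus p.1.right) * A.act p.1.right x.1.left =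
      ι (hS.plus p.1.right) * A.act p.1.right y.1.left := by
    rw [← semigroupW_mul_left_eq p, mul_assoc, hl, mul_assoc]
  obtain ⟨h3, h4⟩ := h₂ _ _ _ _ _ x.2 y.2 hl' hr
  refine semigroupW_ext ?_ h4
  rw [semigroupW_mul_left, semigroupW_mul_left]
  exact congrArg _ h3

theorem semigroupW_isAbundant (h₂ : CancellationCondition hS ι A) :
    IsAbundant (semigroupW hI h₁) where
  exists_rStar p := ⟨plusW p, plusW_idem p, plusW_rStar p⟩
  exists_lStar p := ⟨_, embedW_idem_iff.2 (hS.star p.1.right).2, embedW_star_lStar h₂ p⟩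

/-- `R*`-related idempotents of `W` coincide. -/
theorem semigroupW_eq_of_rStar {p q : semigroupW hI h₁} (hp : IsIdempotentElem p)
    (hq : IsIdempotentElem q) (h : RStar p q) : p = q := by
  have h1 : p * q = q := h.fix hp
  have h2 : q * p = p := h.symm.fix hq
  have hr : p.1.right = q.1.right := by
    have h3 : p.1.right * q.1.right = q.1.right :=
      congrArg (fun q : semigroupW hI h₁ => q.1.right) h1
    have h4 : q.1.right * p.1.right = p.1.right :=
      congrArg (fun q : semigroupW hI h₁ => q.1.right) h2
    rw [← h4, hS.idem_comm _ _ (semigroupW_idem_iff.1 hq) (semigroupW_idem_iff.1 hp), h3]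
  refine semigroupW_ext ?_ hr
  have h5 : p.1.left * A.act p.1.right q.1.left = q.1.left :=
    congrArg (fun q : semigroupW hI h₁ => q.1.left) h1
  -- The left coordinate of `p * q` is that of `p` by absorption and that of `q` by `h5`.
  rw [← left_mul_act (p := p) (x := p.1.right) (q := q), h5]
  rw [← hr]
  exact semigroupW_idem_iff.1 hp

theorem semigroupW_isLeftAdequate (h₂ : CancellationCondition hS ι A) :
    IsLeftAdequate (semigroupW hI h₁) where
  toIsAbundant := semigroupW_isAbundant h₂
  existsUnique_rStar p := ⟨plusW p, ⟨plusW_idem p, plusW_rStar p⟩, fun _ hq =>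
    semigroupW_eq_of_rStar hq.1 (plusW_idem p) (hq.2.trans (plusW_rStar p).symm)⟩

theorem semigroupW_idem_mul {p q : semigroupW hI h₁} (hp : IsIdempotentElem p)
    (hq : IsIdempotentElem q) : IsIdempotentElem (p * q) := by
  rw [semigroupW_idem_iff] at *
  exact IsIdempotentElem.mul_of_commute (hS.idem_comm _ _ hp hq) hp hq

theorem semigroupW_isQuasiAdequate (h₂ : CancellationCondition hS ι A) :
    IsQuasiAdequate (semigroupW hI h₁) where
  toIsAbundant := semigroupW_isAbundant h₂
  idem_mul _ _ := semigroupW_idem_mul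

/-! ### The transversal $W^0$ and the band $I(W)$. -/

variable (hI h₁) in
/-- The subsemigroup `W⁰ = {(x⁺, x)}`. -/
noncomputable def transversalW : Subsemigroup (semigroupW hI h₁) :=
  (embedW hI h₁).srange

variable (hI h₁) in
/-- The isomorphism `x ↦ (x⁺, x)` onto `W⁰`. -/
noncomputable def equivTransversalW : S₀ ≃* transversalW hI h₁ :=
  MulEquiv.ofBijective (embedW hI h₁).srangeRestrict
    ⟨fun _ _ h => embedW_injective (congrArg Subtype.val h),
      (embedW hI h₁).srangeRestrict_surjective⟩

theorem coe_equivTransversalW (x : S₀) :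
    (equivTransversalW hI h₁ x : semigroupW hI h₁) = embedW hI h₁ x := rfl

theorem equivTransversalW_idem_iff {x : S₀} :
    IsIdempotentElem (equivTransversalW hI h₁ x) ↔ IsIdempotentElem x := by
  rw [IsIdempotentElem, ← map_mul, (equivTransversalW hI h₁).injective.eq_iff, IsIdempotentElem]

theorem equivTransversalW_plus (x : S₀) :
    RStar (equivTransversalW hI h₁ (hS.plus x) : semigroupW hI h₁)
      (equivTransversalW hI h₁ x : semigroupW hI h₁) := by
  rw [coe_equivTransversalW, ← plusW_embedW]
  exact plusW_rStar _

theorem equivTransversalW_star (h₂ : CancellationCondition hS ι A) (x : S₀) :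
    LStar (equivTransversalW hI h₁ (hS.star x) : semigroupW hI h₁)
      (equivTransversalW hI h₁ x : semigroupW hI h₁) :=
  embedW_star_lStar h₂ (embedW hI h₁ x)

theorem transversalW_isAdequate (h₂ : CancellationCondition hS ι A) :
    IsAdequate (transversalW hI h₁) where
  exists_rStar a := by
    obtain ⟨x, rfl⟩ := (equivTransversalW hI h₁).surjective a
    have hi := equivTransversalW_idem_iff (hI := hI) (h₁ := h₁).2 (hS.plus x).2
    exact ⟨_, hi, (equivTransversalW_plus x).restrict hi⟩
  exists_lStar a := by
    obtain ⟨x, rfl⟩ := (equivTransversalW hI h₁).surjective a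
    have hi := equivTransversalW_idem_iff (hI := hI) (h₁ := h₁).2 (hS.star x).2
    exact ⟨_, hi, (equivTransversalW_star h₂ x).restrict hi⟩
  idem_comm e f := by
    obtain ⟨x, rfl⟩ := (equivTransversalW hI h₁).surjective e
    obtain ⟨y, rfl⟩ := (equivTransversalW hI h₁).surjective f
    intro hx hy
    rw [equivTransversalW_idem_iff] at hx hy
    rw [← map_mul, ← map_mul, hS.idem_comm _ _ hx hy]

/-- `plus` is a choice, so it has to be identified through uniqueness of the idempotent in an
`R*`-class. -/
theorem transversalW_plus (hW : IsAdequate (transversalW hI h₁)) (x : S₀) :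
    (hW.plus (equivTransversalW hI h₁ x) : transversalW hI h₁) =
      equivTransversalW hI h₁ (hS.plus x) := by
  have hi := equivTransversalW_idem_iff (hI := hI) (h₁ := h₁).2 (hS.plus x).2
  exact (hW.eq_plus hi ((equivTransversalW_plus x).restrict hi)).symm

theorem transversalW_star (h₂ : CancellationCondition hS ι A)
    (hW : IsAdequate (transversalW hI h₁)) (x : S₀) :
    (hW.star (equivTransversalW hI h₁ x) : transversalW hI h₁) =
      equivTransversalW hI h₁ (hS.star x) := by
  have hi := equivTransversalW_idem_iff (hI := hI) (h₁ := h₁).2 (hS.star x).2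
  exact (hW.eq_star hi ((equivTransversalW_star h₂ x).restrict hi)).symm

theorem transversalW_isStarSubsemigroup (h₂ : CancellationCondition hS ι A) :
    IsStarSubsemigroup (transversalW hI h₁) := by
  refine isStarSubsemigroup_of_exists (transversalW_isAdequate h₂) ?_ ?_
  · intro a
    obtain ⟨x, rfl⟩ := (equivTransversalW hI h₁).surjective a
    exact ⟨_, equivTransversalW_idem_iff.2 (hS.plus x).2, equivTransversalW_plus x⟩
  · intro a
    obtain ⟨x, rfl⟩ := (equivTransversalW hI h₁).surjective a
    exact ⟨_, equivTransversalW_idem_iff.2 (hS.star x).2, equivTransversalW_star h₂ x⟩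

theorem transversalW_isLeftAmple (h₂ : CancellationCondition hS ι A) (h : IsLeftAmple S₀) :
    IsLeftAmple (transversalW hI h₁) where
  toIsLeftAdequate := (transversalW_isAdequate h₂).isLeftAdequate
  ample a e p he hp hpa := by
    have hW := transversalW_isAdequate (hI := hI) (h₁ := h₁) h₂
    have hp' := hW.eq_plus hp hpa
    obtain ⟨x, rfl⟩ := (equivTransversalW hI h₁).surjective a
    obtain ⟨y, rfl⟩ := (equivTransversalW hI h₁).surjective e
    rw [hp', ← map_mul, transversalW_plus, ← map_mul]
    exact congrArg _ (h.ample x y _ (equivTransversalW_idem_iff.1 he) (hS.plus (x * y)).2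
      (hS.plus_rStar _))

/-- The decomposition `(e, x) = (e, x⁺)(x⁺, x)(x*, x*)`. -/
theorem semigroupW_isDecomposition (h₂ : CancellationCondition hS ι A)
    (hW : IsAdequate (transversalW hI h₁)) (p : semigroupW hI h₁) :
    IsDecomposition hW p (plusW p) (equivTransversalW hI h₁ p.1.right)
      (embedW hI h₁ (hS.star p.1.right)) where
  idem_left := plusW_idem p
  idem_right := embedW_idem_iff.2 (hS.star p.1.right).2
  eq_mul := by
    have h : plusW p * embedW hI h₁ p.1.right = p :=
      semigroupW_ext (left_mul_act_of_plus_eq (p := p) (congrArg hS.plus (hS.plus_mul_self _)))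
        (hS.plus_mul_self _)
    rw [coe_equivTransversalW, h, mul_embedW_star]
  greenL := by
    have hi := embedW_idem_iff (hI := hI) (h₁ := h₁).2 (hS.plus p.1.right).2
    rw [transversalW_plus, coe_equivTransversalW, greenL_iff_of_idem (plusW_idem p) hi]
    have h : (hS.plus p.1.right : S₀) * hS.plus p.1.right = hS.plus p.1.right :=
      (hS.plus p.1.right).2
    exact ⟨semigroupW_ext (left_mul_act h) h, semigroupW_ext (left_mul_act h) h⟩
  greenR := by
    have hi := embedW_idem_iff (hI := hI) (h₁ := h₁).2 (hS.star p.1.right).2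
    rw [transversalW_star h₂, coe_equivTransversalW, greenR_iff_of_idem hi hi]
    exact ⟨hi, hi⟩

/-- Project to $S^0$, where idempotents commute: there $e\,\mathcal L\,x^+$ and $f\,\mathcal R\,x^*$
become equalities, and the product collapses to $x^+xx^*=x$. -/
theorem eq_of_isDecomposition (h₂ : CancellationCondition hS ι A)
    {hW : IsAdequate (transversalW hI h₁)} {p e f : semigroupW hI h₁} {t : transversalW hI h₁}
    (h : IsDecomposition hW p e t f) : t = equivTransversalW hI h₁ p.1.right := by
  obtain ⟨x, rfl⟩ := (equivTransversalW hI h₁).surjective t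
  have hL := h.greenL
  have hR := h.greenR
  have hip := embedW_idem_iff (hI := hI) (h₁ := h₁).2 (hS.plus x).2
  have his := embedW_idem_iff (hI := hI) (h₁ := h₁).2 (hS.star x).2
  rw [transversalW_plus, coe_equivTransversalW, greenL_iff_of_idem h.idem_left hip] at hL
  rw [transversalW_star h₂, coe_equivTransversalW, greenR_iff_of_idem h.idem_right his] at hR
  have h1 : (hS.plus x : S₀) * e.1.right = hS.plus x :=
    congrArg (fun q : semigroupW hI h₁ => q.1.right) hL.2
  have h2 : e.1.right * (hS.plus x : S₀) = e.1.right :=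
    congrArg (fun q : semigroupW hI h₁ => q.1.right) hL.1
  have h3 : f.1.right * (hS.star x : S₀) = hS.star x :=
    congrArg (fun q : semigroupW hI h₁ => q.1.right) hR.1
  have h4 : (hS.star x : S₀) * f.1.right = f.1.right :=
    congrArg (fun q : semigroupW hI h₁ => q.1.right) hR.2
  have h5 : e.1.right = hS.plus x := by
    rw [← h2, hS.idem_comm _ _ (semigroupW_idem_iff.1 h.idem_left) (hS.plus x).2, h1]
  have h6 : f.1.right = hS.star x := by
    rw [← h4, hS.idem_comm _ _ (hS.star x).2 (semigroupW_idem_iff.1 h.idem_right), h3]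
  have h7 : p.1.right = e.1.right * x * f.1.right :=
    congrArg (fun q : semigroupW hI h₁ => q.1.right) h.eq_mul
  rw [h7, h5, h6, hS.plus_mul_self, hS.mul_star_self]

theorem transversalW_isAdequateTransversal (h₂ : CancellationCondition hS ι A) :
    IsAdequateTransversal (transversalW hI h₁) where
  abundant := semigroupW_isAbundant h₂
  adequate := transversalW_isAdequate h₂
  starSubsemigroup := transversalW_isStarSubsemigroup h₂
  existsUnique p := ⟨_, ⟨_, _, semigroupW_isDecomposition h₂ _ p⟩, by
    rintro t ⟨e, f, h⟩
    exact eq_of_isDecomposition h₂ h⟩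

theorem transversalW_bar (h₂ : CancellationCondition hS ι A)
    (hW : IsAdequateTransversal (transversalW hI h₁)) (p : semigroupW hI h₁) :
    hW.bar p = equivTransversalW hI h₁ p.1.right := by
  obtain ⟨e, f, h⟩ := (hW.existsUnique p).choose_spec.1
  exact eq_of_isDecomposition h₂ h

theorem transversalW_isAdmissible (h₂ : CancellationCondition hS ι A)
    (hW : IsAdequateTransversal (transversalW hI h₁)) : hW.IsAdmissible := by
  intro p q
  rw [transversalW_bar h₂, transversalW_bar h₂, transversalW_bar h₂, semigroupW_mul_right,
    map_mul]

/-- The left factor of $(e,x)$ may be taken to be $(e,x^+)$, so an idempotent is its own left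
factor. -/
theorem transversalW_leftSet (h₂ : CancellationCondition hS ι A)
    (hW : IsAdequateTransversal (transversalW hI h₁)) :
    hW.leftSet = {p | IsIdempotentElem p} := by
  ext p
  constructor
  · rintro ⟨x, f, h⟩
    exact h.idem_left
  · intro hp
    refine ⟨p, embedW hI h₁ (hS.star p.1.right), ?_⟩
    rw [transversalW_bar h₂]
    have h := semigroupW_isDecomposition h₂ hW.adequate p
    have h' : plusW p = p := semigroupW_ext rfl (hS.plus_idem (semigroupW_idem_iff.1 hp))
    rwa [h'] at h

variable (hI h₁) in
/-- The band of idempotents of `W`. -/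
def bandW : Subsemigroup (semigroupW hI h₁) where
  carrier := {p | IsIdempotentElem p}
  mul_mem' := semigroupW_idem_mul

/-- For idempotent $x=x^+$, condition (3) gives $e(x*g)=ex^+g=eg$. -/
theorem bandW_left_mul (h₃ : RestrictionCondition hS ι A) (p q : bandW hI h₁) :
    (p * q).1.1.left = p.1.1.left * q.1.1.left := by
  change p.1.1.left * A.act p.1.1.right q.1.1.left = _
  have h : (hS.plus p.1.1.right : S₀) = p.1.1.right :=
    hS.plus_idem (semigroupW_idem_iff.1 p.2)
  have h3 := h₃ p.1.1.right q.1.1.left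
  rw [h] at h3
  rw [h3, ← mul_assoc, semigroupW_left_mul]

/-- Left regularity shortens $aba=a$ and $bab=b$ to $ab=a$ and $ba=b$. -/
theorem IsLeftRegularBand.isInverseOf_iff (hI : IsLeftRegularBand I) {a b : I} :
    IsInverseOf b a ↔ GreenL a b := by
  rw [hI.greenL_iff, IsInverseOf, hI.left_regular, hI.left_regular]

/-- An idempotent of $W$ is a pair $(e,u)$ with $u\in E^0$ and $e\,\mathcal L\,u$, that is, with $u$
the unique inverse of $e$ in $E^0$; so $e$ determines the pair. -/
theorem bandW_left_bijective (hι : IsSemilatticeTransversal ι) :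
    Function.Bijective fun p : bandW hI h₁ => p.1.1.left := by
  constructor
  · intro p q hpq
    have key : ∀ r : bandW hI h₁, IsInverseOf (ι (hS.plus r.1.1.right)) r.1.1.left :=
      fun r => hI.isInverseOf_iff.2 r.1.2
    have h := (hι.existsUnique_inverse p.1.1.left).unique (key p) (by
      have := key q
      dsimp only at hpq
      rwa [← hpq] at this)
    refine Subtype.ext (semigroupW_ext hpq ?_)
    rw [← hS.plus_idem (semigroupW_idem_iff.1 p.2), h, hS.plus_idem (semigroupW_idem_iff.1 q.2)]
  · intro e
    obtain ⟨u, hu, -⟩ := hι.existsUnique_inverse e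
    have hu' : (⟨e, u⟩ : A.Semidirect) ∈ semigroupW hI h₁ := by
      change GreenL e (ι (hS.plus (u : S₀)))
      rw [hS.plus_semilattice, ← hI.isInverseOf_iff]
      exact hu
    exact ⟨⟨⟨_, hu'⟩, semigroupW_idem_iff.2 u.2⟩, rfl⟩

/-- Under the restriction condition, `E(W)` is isomorphic to `I` by the first projection. -/
noncomputable def bandWEquiv (hι : IsSemilatticeTransversal ι)
    (h₃ : RestrictionCondition hS ι A) : bandW hI h₁ ≃* I :=
  MulEquiv.ofBijective (⟨fun p => p.1.1.left, bandW_left_mul h₃⟩ : bandW hI h₁ →ₙ* I)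
    (bandW_left_bijective hι)

end Construction

end AdequateTransversal

namespace AdequateTransversal

/-! ### The structure of $S$ relative to its transversal. -/

section Converse

variable {S : Type w} [Semigroup S]

/-- `a⁺` in a left adequate semigroup. -/
noncomputable def IsLeftAdequate.plus (hS : IsLeftAdequate S) (a : S) : S :=
  (hS.existsUnique_rStar a).choose

theorem IsLeftAdequate.plus_isIdempotentElem (hS : IsLeftAdequate S) (a : S) :
    IsIdempotentElem (hS.plus a) :=
  (hS.existsUnique_rStar a).choose_spec.1.1

theorem IsLeftAdequate.plus_rStar (hS : IsLeftAdequate S) (a : S) : RStar (hS.plus a) a :=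
  (hS.existsUnique_rStar a).choose_spec.1.2

theorem IsLeftAdequate.eq_plus (hS : IsLeftAdequate S) {a e : S} (he : IsIdempotentElem e)
    (hea : RStar e a) : e = hS.plus a :=
  (hS.existsUnique_rStar a).unique ⟨he, hea⟩ ⟨hS.plus_isIdempotentElem a, hS.plus_rStar a⟩

theorem IsLeftAdequate.plus_idem (hS : IsLeftAdequate S) {e : S} (he : IsIdempotentElem e) :
    hS.plus e = e :=
  (hS.eq_plus he fun _ _ => Iff.rfl).symm

theorem IsLeftAdequate.plus_congr (hS : IsLeftAdequate S) {a b : S} (h : RStar a b) :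
    hS.plus a = hS.plus b :=
  hS.eq_plus (hS.plus_isIdempotentElem a) ((hS.plus_rStar a).trans h)

theorem IsLeftAdequate.plus_mul_self (hS : IsLeftAdequate S) (a : S) : hS.plus a * a = a :=
  (hS.plus_rStar a).fix (hS.plus_isIdempotentElem a)

/-- `(ab⁺)⁺ = (ab)⁺`. -/
theorem IsLeftAdequate.plus_mul_plus (hS : IsLeftAdequate S) (a b : S) :
    hS.plus (a * hS.plus b) = hS.plus (a * b) :=
  hS.plus_congr ((hS.plus_rStar b).mul_left a)

/-- In a left adequate semigroup Green's relation `R` is trivial on idempotents. -/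
theorem IsLeftAdequate.eq_of_mul_eq (hS : IsLeftAdequate S) {e f : S} (he : IsIdempotentElem e)
    (hf : IsIdempotentElem f) (h1 : e * f = f) (h2 : f * e = e) : e = f := by
  have h : RStar e f := rStar_of_idem he h1 fun x y hxy => by
    rw [← h2, ← mul_assoc, hxy, mul_assoc]
  rw [← hS.plus_idem hf]
  exact hS.eq_plus he h

/-- The idempotents $efe$ and $ef$ are left identities of each other, hence equal. -/
theorem IsLeftAdequate.left_regular (hS : IsLeftAdequate S) (hQ : IsQuasiAdequate S) {e f : S}
    (he : IsIdempotentElem e) (hf : IsIdempotentElem f) : e * f * e = e * f := by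
  have hef := hQ.idem_mul e f he hf
  refine hS.eq_of_mul_eq (hQ.idem_mul _ _ hef he) hef ?_ ?_
  · rw [mul_assoc (e * f), ← mul_assoc e e f, he.eq, hef.eq]
  · rw [← mul_assoc, hef.eq]

/-- The band `E(S)`. -/
def IsQuasiAdequate.band (hQ : IsQuasiAdequate S) : Subsemigroup S where
  carrier := {e | IsIdempotentElem e}
  mul_mem' {e f} := hQ.idem_mul e f

theorem IsQuasiAdequate.band_isLeftRegularBand (hQ : IsQuasiAdequate S) (hS : IsLeftAdequate S) :
    IsLeftRegularBand hQ.band where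
  idem e := Subtype.ext e.2
  left_regular e f := Subtype.ext (hS.left_regular hQ e.2 f.2)

variable {T : Subsemigroup S}

theorem IsAdequateTransversal.coe_plus (hT : IsAdequateTransversal T) (hS : IsLeftAdequate S)
    (t : T) : ((hT.adequate.plus t : T) : S) = hS.plus (t : S) :=
  hS.eq_plus (congrArg Subtype.val (hT.adequate.plus t).2)
    ((hT.starSubsemigroup.rStar_iff _ _).1 (hT.adequate.plus_rStar t))

theorem IsAdequateTransversal.star_lStar (hT : IsAdequateTransversal T)
    (t : T) : LStar ((hT.adequate.star t : T) : S) (t : S) :=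
  (hT.starSubsemigroup.lStar_iff _ _).1 (hT.adequate.star_lStar t)

theorem IsAdequateTransversal.eq_bar (hT : IsAdequateTransversal T) {x e f : S} {t : T}
    (h : IsDecomposition hT.adequate x e t f) : t = hT.bar x :=
  (hT.existsUnique x).unique ⟨e, f, h⟩ (hT.existsUnique x).choose_spec.1

/-- If `e L t⁺` then the bar of `et` is `t`. -/
theorem IsAdequateTransversal.bar_mul (hT : IsAdequateTransversal T) {e : S} {t : T}
    (he : IsIdempotentElem e) (h : GreenL e ((hT.adequate.plus t : T) : S)) :
    hT.bar (e * t) = t := by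
  have hs : IsIdempotentElem ((hT.adequate.star t : T) : S) :=
    congrArg Subtype.val (hT.adequate.star t).2
  refine (hT.eq_bar (e := e) (f := (hT.adequate.star t : T)) ⟨he, hs, ?_, h, ?_⟩).symm
  · have := congrArg Subtype.val (hT.adequate.mul_star_self t)
    rw [mul_assoc]
    exact congrArg (e * ·) this.symm
  · rw [greenR_iff_of_idem hs hs]
    exact ⟨hs, hs⟩

theorem IsAdequateTransversal.bar_coe (hT : IsAdequateTransversal T) (t : T) :
    hT.bar (t : S) = t := by
  have hp : IsIdempotentElem ((hT.adequate.plus t : T) : S) :=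
    congrArg Subtype.val (hT.adequate.plus t).2
  have h := hT.bar_mul hp ((greenL_iff_of_idem hp hp).2 ⟨hp, hp⟩)
  have h' : ((hT.adequate.plus t : T) : S) * t = t :=
    congrArg Subtype.val (hT.adequate.plus_mul_self t)
  rwa [h'] at h

/-- If `e L t⁺` then `(et)⁺ = e`. -/
theorem IsAdequateTransversal.plus_mul (hT : IsAdequateTransversal T) (hS : IsLeftAdequate S)
    {e : S} {t : T} (he : IsIdempotentElem e)
    (h : GreenL e ((hT.adequate.plus t : T) : S)) : hS.plus (e * t) = e := by
  have hp : IsIdempotentElem ((hT.adequate.plus t : T) : S) :=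
    congrArg Subtype.val (hT.adequate.plus t).2
  rw [greenL_iff_of_idem he hp, hT.coe_plus hS] at h
  rw [← hS.plus_mul_plus, h.1, hS.plus_idem he]

/-- The right factor is `R`-related to $\bar x^*$, hence equal to it, and $\bar x$ absorbs it. -/
theorem IsAdequateTransversal.exists_eq_mul_bar (hT : IsAdequateTransversal T)
    (hS : IsLeftAdequate S) (x : S) : ∃ e : S, IsIdempotentElem e ∧
      GreenL e ((hT.adequate.plus (hT.bar x) : T) : S) ∧ x = e * hT.bar x := by
  obtain ⟨e, f, h⟩ := (hT.existsUnique x).choose_spec.1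
  change IsDecomposition hT.adequate x e (hT.bar x) f at h
  refine ⟨e, h.idem_left, h.greenL, ?_⟩
  have hs : IsIdempotentElem ((hT.adequate.star (hT.bar x) : T) : S) :=
    congrArg Subtype.val (hT.adequate.star (hT.bar x)).2
  have hR := h.greenR
  rw [greenR_iff_of_idem h.idem_right hs] at hR
  have hf := hS.eq_of_mul_eq h.idem_right hs hR.1 hR.2
  have h1 : (hT.bar x : S) * ((hT.adequate.star (hT.bar x) : T) : S) = hT.bar x :=
    congrArg Subtype.val (hT.adequate.mul_star_self (hT.bar x))
  conv_lhs => rw [h.eq_mul, hf, mul_assoc, h1]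

/-- From $x=e\bar x$ with $e\,\mathcal L\,\bar x^+$ one gets $x^+=e$: the left factor is $x^+$. -/
theorem IsAdequateTransversal.plus_greenL (hT : IsAdequateTransversal T) (hS : IsLeftAdequate S)
    (x : S) : GreenL (hS.plus x) ((hT.adequate.plus (hT.bar x) : T) : S) := by
  obtain ⟨e, he, hL, hx⟩ := hT.exists_eq_mul_bar hS x
  have h := hT.plus_mul hS he hL
  rw [← hx] at h
  rwa [h]

/-- `x = x⁺ x̄`. -/
theorem IsAdequateTransversal.plus_mul_bar (hT : IsAdequateTransversal T) (hS : IsLeftAdequate S)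
    (x : S) : hS.plus x * hT.bar x = x := by
  obtain ⟨e, he, hL, hx⟩ := hT.exists_eq_mul_bar hS x
  have h := hT.plus_mul hS he hL
  rw [← hx] at h
  rw [h, ← hx]

theorem IsAdequateTransversal.bar_idem (hT : IsAdequateTransversal T) (hA : hT.IsAdmissible)
    {e : S} (he : IsIdempotentElem e) : IsIdempotentElem (hT.bar e) := by
  rw [IsIdempotentElem, ← hA, he.eq]

/-- The left ample identity `te = (te)⁺t` holds for `t` in the transversal and every idempotent `e`
of `S`. -/
theorem IsAdequateTransversal.mul_idem_eq (hT : IsAdequateTransversal T) (hS : IsLeftAdequate S)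
    (hA : hT.IsAdmissible) (hample : IsLeftAmple T) (t : T) {e : S} (he : IsIdempotentElem e) :
    (t : S) * e = hS.plus (t * e) * t := by
  have h1 := hT.plus_mul_bar hS (t * e)
  have hL := hT.plus_greenL hS (t * e)
  -- Admissibility makes the bar of $te$ equal to $t\bar e$, so $te=(te)^+t\bar e$. Left ampleness
  -- in `T` moves $\bar e$ across $t$, and $(te)^+$ absorbs $(t\bar e)^+$.
  rw [hA, hT.bar_coe] at h1 hL
  have hp : IsIdempotentElem ((hT.adequate.plus (t * hT.bar e) : T) : S) :=
    congrArg Subtype.val (hT.adequate.plus (t * hT.bar e)).2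
  have h2 : (t : S) * (hT.bar e : S) = ((hT.adequate.plus (t * hT.bar e) : T) : S) * t :=
    congrArg Subtype.val (hample.ample t (hT.bar e) _ (hT.bar_idem hA he)
      (hT.adequate.plus (t * hT.bar e)).2 (hT.adequate.plus_rStar _))
  rw [greenL_iff_of_idem (hS.plus_isIdempotentElem _) hp] at hL
  conv_lhs => rw [← h1]
  rw [MulMemClass.coe_mul, h2, ← mul_assoc, hL.1]

/-! ### The action on $E(S)$ and the isomorphism with $W$. -/

/-- The action `t ∗ e = (te)⁺` of the transversal on `E(S)`. -/
noncomputable def IsAdequateTransversal.action (hT : IsAdequateTransversal T)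
    (hS : IsLeftAdequate S) (hQ : IsQuasiAdequate S) (hA : hT.IsAdmissible)
    (hample : IsLeftAmple T) : DistribAction T hQ.band where
  act t e := ⟨hS.plus (t * e), hS.plus_isIdempotentElem _⟩
  mul_act x y e := Subtype.ext (by
    dsimp only
    rw [hS.plus_mul_plus, MulMemClass.coe_mul, mul_assoc])
  act_mul x e f := Subtype.ext (by
    -- Replace $xe$ by $(xe)^+x$; applying ${}^+$ then gives the product $(xe)^+(xf)^+$, already
    -- idempotent as $S$ is quasi-adequate.
    have h : (x : S) * (e * f) = hS.plus (x * e) * (x * f) := by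
      rw [← mul_assoc, ← mul_assoc, ← hT.mul_idem_eq hS hA hample x e.2]
    change hS.plus (x * (e * f)) = hS.plus (x * e) * hS.plus (x * f)
    rw [h, ← hS.plus_mul_plus]
    exact hS.plus_idem
      (hQ.idem_mul _ _ (hS.plus_isIdempotentElem _) (hS.plus_isIdempotentElem _)))

theorem IsAdequateTransversal.coe_act (hT : IsAdequateTransversal T)
    (hS : IsLeftAdequate S) (hQ : IsQuasiAdequate S) (hA : hT.IsAdmissible)
    (hample : IsLeftAmple T) (t : T) (e : hQ.band) :
    (((hT.action hS hQ hA hample).act t e : hQ.band) : S) = hS.plus (t * e) := rfl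

/-- The inclusion of `E(T)` into `E(S)`. -/
def IsAdequateTransversal.inclusion (hT : IsAdequateTransversal T) (hQ : IsQuasiAdequate S) :
    hT.adequate.semilattice →ₙ* hQ.band where
  toFun e := ⟨((e : T) : S), congrArg Subtype.val e.2⟩
  map_mul' _ _ := rfl

theorem IsAdequateTransversal.coe_inclusion (hT : IsAdequateTransversal T)
    (hQ : IsQuasiAdequate S) (e : hT.adequate.semilattice) :
    ((hT.inclusion hQ e : hQ.band) : S) = ((e : T) : S) := rfl

theorem IsQuasiAdequate.band_greenL_iff (hQ : IsQuasiAdequate S) {e f : hQ.band} :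
    GreenL e f ↔ GreenL (e : S) (f : S) := by
  rw [greenL_iff_of_idem e.2 f.2,
    greenL_iff_of_idem (a := e) (b := f) (Subtype.ext e.2) (Subtype.ext f.2), Subtype.ext_iff,
    Subtype.ext_iff]
  rfl

theorem IsAdequateTransversal.inclusion_isSemilatticeTransversal (hT : IsAdequateTransversal T)
    (hS : IsLeftAdequate S) (hQ : IsQuasiAdequate S) (hA : hT.IsAdmissible) :
    IsSemilatticeTransversal (hT.inclusion hQ) where
  injective e f h :=
    Subtype.ext (Subtype.ext (congrArg (fun x : hQ.band => (x : S)) h))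
  existsUnique_inverse e := by
    have hI := hQ.band_isLeftRegularBand hS
    refine ⟨⟨hT.bar e, hT.bar_idem hA e.2⟩, ?_, ?_⟩
    · have h := hT.plus_greenL hS (e : S)
      rw [hS.plus_idem e.2, hT.adequate.plus_idem (hT.bar_idem hA e.2)] at h
      exact hI.isInverseOf_iff.2 (hQ.band_greenL_iff.2 h)
    · intro u hu
      have hL : GreenL (e : S) ((u : T) : S) :=
        hQ.band_greenL_iff.1 (hI.isInverseOf_iff.1 hu)
      -- Uniqueness: $e=eu$ with $e\,\mathcal L\,u=u^+$ is a decomposition of $e$ through $u$, so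
      -- $u=\bar e$.
      have hmul := ((greenL_iff_of_idem e.2 (congrArg Subtype.val u.2)).1 hL).1
      have h := hT.bar_mul (t := (u : T)) e.2 (by rwa [hT.adequate.plus_idem u.2])
      rw [hmul] at h
      exact Subtype.ext h.symm

theorem IsAdequateTransversal.plusCondition (hT : IsAdequateTransversal T)
    (hS : IsLeftAdequate S) (hQ : IsQuasiAdequate S) (hA : hT.IsAdmissible)
    (hample : IsLeftAmple T) :
    PlusCondition hT.adequate (hT.inclusion hQ) (hT.action hS hQ hA hample) := by
  intro x y
  refine Subtype.ext ?_
  rw [hT.coe_act, hT.coe_inclusion, hT.coe_inclusion, hT.coe_plus hS, hT.coe_plus hS,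
    hS.plus_mul_plus, MulMemClass.coe_mul]

theorem IsAdequateTransversal.restrictionCondition (hT : IsAdequateTransversal T)
    (hS : IsLeftAdequate S) (hQ : IsQuasiAdequate S) (hA : hT.IsAdmissible)
    (hample : IsLeftAmple T) :
    RestrictionCondition hT.adequate (hT.inclusion hQ) (hT.action hS hQ hA hample) := by
  intro x e
  refine Subtype.ext ?_
  rw [hT.coe_act, MulMemClass.coe_mul, hT.coe_inclusion]
  exact hS.plus_idem (hQ.idem_mul _ _ (congrArg Subtype.val (hT.adequate.plus x).2) e.2)

/-- Since $x^+$ fixes each $(xe_i)^+$, the premise says $(xe_1)^+=(xe_2)^+$. Multiplying by $x$ on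
the right gives $xe_1=xe_2$, and $x\,\mathcal L^*\,x^*$ cancels $x$ down to $x^*$. -/
theorem IsAdequateTransversal.cancellationCondition (hT : IsAdequateTransversal T)
    (hS : IsLeftAdequate S) (hQ : IsQuasiAdequate S) (hA : hT.IsAdmissible)
    (hample : IsLeftAmple T) :
    CancellationCondition hT.adequate (hT.inclusion hQ) (hT.action hS hQ hA hample) := by
  intro x x₁ x₂ e₁ e₂ _ _ h hx
  refine ⟨Subtype.ext ?_, (hT.adequate.star_lStar x).symm.cancel hx⟩
  have hplus (e : S) : hS.plus (x : S) * hS.plus (x * e) = hS.plus (x * e) :=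
    (hS.plus_rStar (x * e)).symm.fix (by rw [← mul_assoc, hS.plus_mul_self])
  have h1 := congrArg Subtype.val h
  rw [MulMemClass.coe_mul, MulMemClass.coe_mul, hT.coe_inclusion, hT.coe_plus hS, hT.coe_act,
    hT.coe_act, hplus, hplus] at h1
  have h2 : (x : S) * (e₁ : S) = x * e₂ := by
    rw [hT.mul_idem_eq hS hA hample x e₁.2, h1, ← hT.mul_idem_eq hS hA hample x e₂.2]
  rw [hT.coe_act, hT.coe_act, (hT.star_lStar x).symm.cancel h2]

/-- The isomorphism `x ↦ (x⁺, x̄)` of `S` onto `W`. -/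
noncomputable def IsAdequateTransversal.equivW (hT : IsAdequateTransversal T)
    (hS : IsLeftAdequate S) (hQ : IsQuasiAdequate S) (hA : hT.IsAdmissible)
    (hample : IsLeftAmple T) :
    S ≃* semigroupW (hQ.band_isLeftRegularBand hS) (hT.plusCondition hS hQ hA hample) :=
  MulEquiv.ofBijective
    (⟨fun x => ⟨⟨⟨hS.plus x, hS.plus_isIdempotentElem x⟩, hT.bar x⟩,
        hQ.band_greenL_iff.2 (hT.plus_greenL hS x)⟩, fun x y => by
      refine semigroupW_ext (Subtype.ext ?_) (hA x y)
      change hS.plus (x * y) = hS.plus x * hS.plus (hT.bar x * hS.plus y)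
      -- With $x=x^+\bar x$, both sides reduce to $x^+(\bar xy)^+$, a product of idempotents and so
      -- fixed by ${}^+$.
      conv_lhs => rw [← hT.plus_mul_bar hS x]
      rw [hS.plus_mul_plus, mul_assoc, ← hS.plus_mul_plus]
      exact hS.plus_idem
        (hQ.idem_mul _ _ (hS.plus_isIdempotentElem _) (hS.plus_isIdempotentElem _))⟩ :
      S →ₙ* semigroupW (hQ.band_isLeftRegularBand hS) (hT.plusCondition hS hQ hA hample))
    ⟨fun x y h => by
      have h1 : hS.plus x = hS.plus y := congrArg (fun p => (p.1.left : S)) h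
      have h2 : hT.bar x = hT.bar y := congrArg (fun p => p.1.right) h
      rw [← hT.plus_mul_bar hS x, h1, h2, hT.plus_mul_bar hS y],
    fun p => by
      have hL : GreenL (p.1.left : S) ((hT.adequate.plus p.1.right : T) : S) :=
        hQ.band_greenL_iff.1 p.2
      -- The preimage of $(e,t)$ is $et$: as $e\,\mathcal L\,t^+$, it has $(et)^+=e$ and bar $t$.
      exact ⟨p.1.left * p.1.right, semigroupW_ext
        (Subtype.ext (hT.plus_mul hS p.1.left.2 hL)) (hT.bar_mul p.1.left.2 hL)⟩⟩

theorem IsAdequateTransversal.equivW_coe (hT : IsAdequateTransversal T)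
    (hS : IsLeftAdequate S) (hQ : IsQuasiAdequate S) (hA : hT.IsAdmissible)
    (hample : IsLeftAmple T) (t : T) :
    (hT.equivW hS hQ hA hample (t : S)).1 = ⟨hT.inclusion hQ (hT.adequate.plus t), t⟩ :=
  DistribAction.Semidirect.ext (Subtype.ext (hT.coe_plus hS t).symm) (hT.bar_coe t)

end Converse

end AdequateTransversal

theorem mainTheorem3 :
    -- the construction
    (∀ (S₀ : Type u) (I : Type v) [Semigroup S₀] [Semigroup I]
      (hS : IsAdequate S₀) (_ : IsLeftAmple S₀) (hI : IsLeftRegularBand I)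
      (ι : hS.semilattice →ₙ* I) (_ : IsSemilatticeTransversal ι)
      (A : DistribAction S₀ I) (h₁ : PlusCondition hS ι A) (_ : CancellationCondition hS ι A),
      IsLeftAdequate (semigroupW hI h₁) ∧ IsQuasiAdequate (semigroupW hI h₁) ∧
      ∃ (W₀ : Subsemigroup (semigroupW hI h₁)) (hW₀ : IsAdequateTransversal W₀),
        hW₀.IsAdmissible ∧ IsLeftAmple W₀ ∧
        (∃ ψ : S₀ ≃* W₀, ∀ x : S₀,
          ((ψ x : semigroupW hI h₁) : A.Semidirect) = ⟨ι (hS.plus x), x⟩) ∧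
        (RestrictionCondition hS ι A →
          ∃ J : Subsemigroup (semigroupW hI h₁),
            (J : Set (semigroupW hI h₁)) = hW₀.leftSet ∧ Nonempty (J ≃* I))) ∧
    -- the converse
    (∀ (S : Type w) [Semigroup S] (_ : IsLeftAdequate S) (_ : IsQuasiAdequate S)
      (T : Subsemigroup S) (hT : IsAdequateTransversal T) (_ : hT.IsAdmissible)
      (_ : IsLeftAmple T),
      ∃ (I : Type w) (_ : Semigroup I) (hI : IsLeftRegularBand I)
        (ι : hT.adequate.semilattice →ₙ* I) (_ : IsSemilatticeTransversal ι)
        (A : DistribAction T I) (h₁ : PlusCondition hT.adequate ι A)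
        (_ : CancellationCondition hT.adequate ι A)
        (_ : RestrictionCondition hT.adequate ι A)
        (φ : S ≃* semigroupW hI h₁),
        ∀ t : T, ((φ t : semigroupW hI h₁) : A.Semidirect) = ⟨ι (hT.adequate.plus t), t⟩) := by
  refine ⟨?_, ?_⟩
  · intro S₀ I _ _ hS hample hI ι hι A h₁ h₂
    refine ⟨semigroupW_isLeftAdequate h₂, semigroupW_isQuasiAdequate h₂, transversalW hI h₁,
      transversalW_isAdequateTransversal h₂, transversalW_isAdmissible h₂ _,
      transversalW_isLeftAmple h₂ hample, ⟨equivTransversalW hI h₁, fun _ => rfl⟩, fun h₃ => ?_⟩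
    exact ⟨bandW hI h₁, (transversalW_leftSet h₂ _).symm, ⟨bandWEquiv hι h₃⟩⟩
  · intro S _ hS hQ T hT hA hample
    exact ⟨hQ.band, inferInstance, hQ.band_isLeftRegularBand hS, hT.inclusion hQ,
      hT.inclusion_isSemilatticeTransversal hS hQ hA, hT.action hS hQ hA hample,
      hT.plusCondition hS hQ hA hample, hT.cancellationCondition hS hQ hA hample,
      hT.restrictionCondition hS hQ hA hample, hT.equivW hS hQ hA hample,
      hT.equivW_coe hS hQ hA hample⟩
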